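/- Let $E$ be a Dedekind complete Riesz space. A *conditional expectation operator* on $E$ is a positive order continuous linear projection $T\colon E\to E$ whose range $R(T)$ is a Dedekind complete Riesz subspace of $E$ and which maps weak order units of $E$ to weak order units of $E$. Let $T$ be a conditional expectation operator on $E$ and let $e$ be a weak order unit of $E$ with $Te=e$. Suppose that $E$ is $T$-universally complete, $E=L^1(T)$: every upwards directed net $(f_\alpha)$ in $E_+$ for which $(Tf_\alpha)$ is order bounded in the universal completion $E^u$ of $E$ is order convergent in $E$. Let $U$ and $V$ be conditional expectation operators on $E$ compatible with $T$, that is, $TU=T=UT$ and $TV=T=VT$. Put $L^\infty(T)=\{f\in E : |f|\le g \text{ for some } g\in R(T)_+\}$ and $$\|f\|_{T,1}=T|f|\quad (f\in E),\qquad \|f\|_{T,\infty}=\inf\{g\in R(T)_+ : |f|\le g\}\quad (f\in L^\infty(T)).$$ Let $\mathcal B(V)$ be the set of band projections $Q$ on $E$ with $Qe\in R(V)$, and let $$\varphi_T(U,V)=\sup_{Q\in\mathcal B(V)}\|UQe-TQe\|_{T,\infty}.$$ Products are taken in the $f$-algebra $R(T)$ with algebraic unit $e$. Then for every $f\in L^\infty(T)\cap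 R(V)$ the elements $UQe-TQe$ (for $Q\in\mathcal B(V)$) and $Uf-Tf$ belong to $L^\infty(T)$, the supremum $\varphi_T(U,V)$ exists, and $$\|Uf-Tf\|_{T,1}\le\|Uf-Tf\|_{T,\infty}\le 2\,\varphi_T(U,V)\,\|f\|_{T,\infty}.$$ -/

import Mathlib

universe u

namespace RieszMixing

section Basic

/- A Dedekind complete Riesz space: an ordered real vector space that is a lattice in which every
nonempty subset that is bounded above has a supremum. -/
variable {E : Type u} [AddCommGroup E] [ConditionallyCompleteLattice E] [IsOrderedAddMonoid E]
  [Module ℝ E] [IsOrderedModule ℝ E]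

/-- `e` is a weak order unit: it is positive and only `0` is disjoint from it. -/
def IsWeakOrderUnit (e : E) : Prop :=
  0 ≤ e ∧ ∀ x : E, e ⊓ |x| = 0 → x = 0

/-- Order continuity of a positive operator: `x_α ↓ 0` implies `T x_α ↓ 0`. -/
def IsOrderContinuous (T : E →ₗ[ℝ] E) : Prop :=
  ∀ D : Set E, D.Nonempty → DirectedOn (· ≥ ·) D → IsGLB D 0 → IsGLB (T '' D) 0

/-- A conditional expectation operator on `E`: a positive order continuous linear projection whose
range is a Dedekind complete Riesz subspace of `E` and which maps weak order units to weak order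
units. -/
structure IsCondExp (T : E →ₗ[ℝ] E) : Prop where
  nonneg : ∀ x, 0 ≤ x → 0 ≤ T x
  idem : ∀ x, T (T x) = T x
  orderContinuous : IsOrderContinuous T
  sup_mem_range : ∀ x ∈ LinearMap.range T, ∀ y ∈ LinearMap.range T, x ⊔ y ∈ LinearMap.range T
  range_dedekindComplete : ∀ S : Set (LinearMap.range T), S.Nonempty → BddAbove S →
    ∃ s, IsLUB S s
  weakOrderUnit : ∀ e, IsWeakOrderUnit e → IsWeakOrderUnit (T e)

/-- `U` is compatible with `T`: `TU = T = UT`. -/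
def IsCompatible (T U : E →ₗ[ℝ] E) : Prop :=
  (∀ x, T (U x) = T x) ∧ ∀ x, U (T x) = T x

/-- A band: a solid linear subspace that contains the supremum of each of its nonempty subsets
that has one in `E`. -/
def IsBand (B : Submodule ℝ E) : Prop :=
  (∀ x ∈ B, ∀ y : E, |y| ≤ |x| → y ∈ B) ∧
    ∀ S : Set E, S.Nonempty → S ⊆ B → ∀ s, IsLUB S s → s ∈ B

/-- A band projection: for some band `B`, every `x` is the sum of `P x ∈ B` and of an element
`x - P x` of the disjoint complement of `B`. -/
def IsBandProjection (P : E →ₗ[ℝ] E) : Prop :=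
  ∃ B : Submodule ℝ E, IsBand B ∧ ∀ x, P x ∈ B ∧ ∀ y ∈ B, |x - P x| ⊓ |y| = 0

/-- The set `𝓑(U)` of the band projections `P` on `E` with `P e ∈ R(U)`. -/
def bandProjections (e : E) (U : E →ₗ[ℝ] E) : Set (E →ₗ[ℝ] E) :=
  {P | IsBandProjection P ∧ P e ∈ LinearMap.range U}

/-- The set `{g ∈ R(T)₊ : |f| ≤ g}` of the `R(T)`-bounds of `f`. -/
def rangeBounds (T : E →ₗ[ℝ] E) (f : E) : Set E :=
  {g | g ∈ LinearMap.range T ∧ 0 ≤ g ∧ |f| ≤ g}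

/-- `L^∞(T)`, for `E = L^1(T)`: the elements of `E` that are bounded by an element of `R(T)₊`. -/
def LInfty (T : E →ₗ[ℝ] E) : Set E :=
  {f | (rangeBounds T f).Nonempty}

/-- The vector-valued norm `‖f‖_{T,1} = T|f|`. -/
def norm1 (T : E →ₗ[ℝ] E) (f : E) : E := T |f|

/-- The vector-valued norm `‖f‖_{T,∞} = inf {g ∈ R(T)₊ : |f| ≤ g}`. -/
noncomputable def normInfty (T : E →ₗ[ℝ] E) (f : E) : E := sInf (rangeBounds T f)

/-- The set `{‖UQe - TQe‖_{T,∞} : Q ∈ 𝓑(V)}`. -/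
def phiSet (e : E) (T U V : E →ₗ[ℝ] E) : Set E :=
  (fun Q : E →ₗ[ℝ] E => normInfty T (U (Q e) - T (Q e))) '' bandProjections e V

/-- The `T`-conditional uniform mixing coefficient
`φ_T(U,V) = sup {‖UQe - TQe‖_{T,∞} : Q ∈ 𝓑(V)}`. -/
noncomputable def phi (e : E) (T U V : E →ₗ[ℝ] E) : E := sSup (phiSet e T U V)

/-- The elements `st • p`, where `p` is a component of `e` (that is, `p ∧ (e - p) = 0`) and
`s, t ≥ 0` are reals with `s • p ≤ a` and `t • p ≤ b`. In a representation of `E` by extended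
real-valued functions in which `e` is the constant function `1`, the components are the indicator
functions in `E`. -/
def mulSet (e a b : E) : Set E :=
  {x | ∃ (s t : ℝ) (p : E), 0 ≤ s ∧ 0 ≤ t ∧ p ⊓ (e - p) = 0 ∧ s • p ≤ a ∧ t • p ≤ b ∧
    x = (s * t) • p}

/-- The product `a · b` of two elements `a, b ≥ 0` for the `f`-algebra multiplication whose unit
is the weak order unit `e`: the supremum of the products `(s • p) · (t • p) = st • p` of multiples
`s • p ≤ a` and `t • p ≤ b` of components of `e`. -/
noncomputable def mulPos (e a b : E) : E := sSup (mulSet e a b)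

end Basic

section UniversalCompletion

/-- `F` is universally complete (being Dedekind complete already): every nonempty set of mutually
disjoint positive elements has a supremum. -/
def IsUniversallyComplete (F : Type*) [AddCommGroup F] [ConditionallyCompleteLattice F] : Prop :=
  ∀ S : Set F, S.Nonempty → (∀ x ∈ S, 0 ≤ x) → S.Pairwise (fun x y => x ⊓ y = 0) →
    ∃ s, IsLUB S s

/-- `J : E → F` is a universal completion of `E`: `F` is universally complete and `J` is an
injective Riesz homomorphism with order dense range. -/
structure IsUniversalCompletion {E F : Type*}
    [AddCommGroup E] [ConditionallyCompleteLattice E] [Module ℝ E]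
    [AddCommGroup F] [ConditionallyCompleteLattice F] [Module ℝ F] (J : E →ₗ[ℝ] F) : Prop where
  universallyComplete : IsUniversallyComplete F
  injective : Function.Injective J
  map_sup : ∀ x y, J (x ⊔ y) = J x ⊔ J y
  orderDense : ∀ y : F, 0 < y → ∃ x : E, 0 < J x ∧ J x ≤ y

variable {E : Type u} [AddCommGroup E] [ConditionallyCompleteLattice E] [Module ℝ E]

/-- The set `S` is bounded above in the universal completion of `E` (which is unique up to
isomorphism). -/
def BddAboveInUniversalCompletion (S : Set E) : Prop :=
  ∃ (F : Type u) (_ : AddCommGroup F) (_ : ConditionallyCompleteLattice F)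
    (_ : IsOrderedAddMonoid F) (_ : Module ℝ F) (_ : IsOrderedModule ℝ F) (J : E →ₗ[ℝ] F),
    IsUniversalCompletion J ∧ BddAbove (J '' S)

/-- `E` is `T`-universally complete, `E = L^1(T)`: every upwards directed subset (net) `D` of
`E₊` such that `T(D)` is order bounded in the universal completion of `E` converges in order,
that is, has a supremum in `E`. -/
def IsTUniversallyComplete (T : E →ₗ[ℝ] E) : Prop :=
  ∀ D : Set E, D.Nonempty → (∀ x ∈ D, 0 ≤ x) → DirectedOn (· ≤ ·) D →
    BddAboveInUniversalCompletion (T '' D) → ∃ s, IsLUB D s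

end UniversalCompletion

end RieszMixing

/-!
For a real bound `t`, an element `g` of `R(V)` with `0 ≤ g ≤ t e` is the "integral"
`∫₀ᵗ Q_s e ds`, where the order projection `Q_s` selects the part where `g > s e`. Each `Q_s e` lies
in `R(V)`, so `|U Q_s e - T Q_s e| ≤ φ` and hence `|U g - T g| ≤ t φ`. Treating positive and negative
parts separately gives `|U g - T g| ≤ 2 t φ` for `|g| ≤ t e`. The integral is replaced by finite
sums with step `δ` (`IsCondExp.exists_step_approx`, `abs_sub_le_of_abs_le_smul`).

The actual bound `m = ‖f‖_{T,∞}` is not a multiple of `e` but an element of `R(T)`. An order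
projection `R` with `R e ∈ R(T)` commutes with `T`, `U` and `V` (`IsCondExp.commute`), so the real
estimate applies to `R f` for each `R` that selects a part where both `φ` and `m` lie between
consecutive multiples of `δ e`. Such parts exhaust the space
(`IsCondExp.le_of_forall_orderProjection`), and the components `R e` occur in the definition of the
product, which gives `|U f - T f| ≤ 2 φ · m` up to an error of order `δ` (`abs_sub_le_two_smul`).

The norm `‖U f - T f‖_{T,∞}` is only bounded by bounds that lie in `R(T)`. Therefore the product is
replaced by the possibly smaller supremum over the components in `R(T)` (`rangeMulSet`), which is in
`R(T)` because `R(T)` is closed under suprema (`IsCondExp.mem_range_of_isLUB`).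
-/

set_option linter.unusedSectionVars false

namespace RieszMixing

/-! ### Disjoint complements and principal order projections -/

section Lattice

variable {E : Type u} [AddCommGroup E] [Lattice E] [IsOrderedAddMonoid E]

lemma add_inf_le {a b c : E} (ha : 0 ≤ a) (hb : 0 ≤ b) (hc : 0 ≤ c) :
    (a + b) ⊓ c ≤ a ⊓ c + b ⊓ c := by
  rw [add_inf, inf_add, inf_add]
  refine le_inf (le_inf inf_le_left ?_) (le_inf ?_ ?_)
  · exact inf_le_right.trans (le_add_of_nonneg_right hb)
  · exact inf_le_right.trans (le_add_of_nonneg_left ha)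
  · exact inf_le_right.trans (le_add_of_nonneg_left hc)

lemma inf_eq_zero_of_le {a b a' b' : E} (h : a ⊓ b = 0) (ha' : 0 ≤ a') (hb' : 0 ≤ b')
    (ha : a' ≤ a) (hb : b' ≤ b) : a' ⊓ b' = 0 :=
  le_antisymm ((inf_le_inf ha hb).trans h.le) (le_inf ha' hb')

lemma add_inf_eq_zero {a b c : E} (ha : 0 ≤ a) (hb : 0 ≤ b) (hc : 0 ≤ c)
    (hac : a ⊓ c = 0) (hbc : b ⊓ c = 0) : (a + b) ⊓ c = 0 :=
  le_antisymm ((add_inf_le ha hb hc).trans (by simp [hac, hbc])) (le_inf (add_nonneg ha hb) hc)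

lemma nsmul_inf_eq_zero {a c : E} (ha : 0 ≤ a) (hc : 0 ≤ c) (hac : a ⊓ c = 0) (n : ℕ) :
    (n • a) ⊓ c = 0 := by
  induction n with
  | zero => simpa using hc
  | succ n ih => rw [succ_nsmul]; exact add_inf_eq_zero (nsmul_nonneg ha n) ha hc ih hac

lemma eq_zero_of_abs_le {x : E} (h : |x| ≤ 0) : x = 0 :=
  le_antisymm ((le_abs_self x).trans h) (neg_nonpos.1 ((neg_le_abs x).trans h))

end Lattice

variable {E : Type u} [AddCommGroup E] [ConditionallyCompleteLattice E] [IsOrderedAddMonoid E]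
  [Module ℝ E] [IsOrderedModule ℝ E]

/-- A Dedekind complete Riesz space is Archimedean. -/
lemma le_zero_of_forall_nat_smul_le {x y : E} (h : ∀ n : ℕ, (n : ℝ) • x ≤ y) : x ≤ 0 := by
  have hlub : IsLUB (Set.range fun n : ℕ => (n : ℝ) • x)
      (sSup (Set.range fun n : ℕ => (n : ℝ) • x)) :=
    isLUB_csSup (Set.range_nonempty _) ⟨y, by rintro _ ⟨n, rfl⟩; exact h n⟩
  have h1 : sSup (Set.range fun n : ℕ => (n : ℝ) • x) ≤
      sSup (Set.range fun n : ℕ => (n : ℝ) • x) - x := by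
    refine hlub.2 ?_
    rintro _ ⟨n, rfl⟩
    have := hlub.1 ⟨n + 1, rfl⟩
    rw [le_sub_iff_add_le]
    convert this using 1
    push_cast
    module
  simpa using h1

lemma le_of_forall_nat_smul_sub_le {x y z : E} (h : ∀ n : ℕ, (n : ℝ) • (x - y) ≤ z) : x ≤ y :=
  sub_nonpos.1 (le_zero_of_forall_nat_smul_le h)

lemma abs_smul_le (c : ℝ) (x : E) : |c • x| ≤ |c| • |x| := by
  have h1 : ∀ (c : ℝ) (x : E), c • x ≤ |c| • |x| := by
    intro c x
    rcases le_total 0 c with hc | hc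
    · rw [abs_of_nonneg hc]; exact smul_le_smul_of_nonneg_left (le_abs_self x) hc
    · rw [abs_of_nonpos hc, ← neg_smul_neg c x]
      exact smul_le_smul_of_nonneg_left (neg_le_abs x) (neg_nonneg.2 hc)
  refine abs_le'.2 ⟨h1 c x, ?_⟩
  rw [← neg_smul, ← abs_neg c]
  exact h1 _ _

/-- The disjoint complement `{x | |x| ∧ |y| = 0 for all y ∈ S}` of a set `S`. -/
def disjointCompl (S : Set E) : Submodule ℝ E where
  carrier := {x | ∀ y ∈ S, |x| ⊓ |y| = 0}
  zero_mem' := fun y _ => by simp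
  add_mem' := fun {a b} ha hb y hy =>
    inf_eq_zero_of_le (add_inf_eq_zero (abs_nonneg a) (abs_nonneg b) (abs_nonneg y) (ha y hy)
      (hb y hy)) (abs_nonneg _) (abs_nonneg _) (abs_add_le a b) le_rfl
  smul_mem' := fun c x hx y hy => by
    obtain ⟨n, hn⟩ := exists_nat_ge |c|
    refine inf_eq_zero_of_le (nsmul_inf_eq_zero (abs_nonneg x) (abs_nonneg y) (hx y hy) n)
      (abs_nonneg _) (abs_nonneg _) ((abs_smul_le c x).trans ?_) le_rfl
    rw [← Nat.cast_smul_eq_nsmul ℝ]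
    exact smul_le_smul_of_nonneg_right hn (abs_nonneg x)

/-- An order projection: an idempotent linear operator between `0` and the identity. These are
exactly the band projections; this form of the definition does not mention the band. -/
structure IsOrderProjection (P : E →ₗ[ℝ] E) : Prop where
  nonneg : ∀ x, 0 ≤ x → 0 ≤ P x
  le_self : ∀ x, 0 ≤ x → P x ≤ x
  idem : ∀ x, P (P x) = P x

lemma exists_isLUB_inf {u x : E} :
    ∃ p, IsLUB (Set.range fun n : ℕ => ((n : ℝ) • u) ⊓ x) p :=
  ⟨_, isLUB_csSup (Set.range_nonempty _) ⟨x, by rintro _ ⟨n, rfl⟩; exact inf_le_right⟩⟩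

lemma isLUB_inf_bounds {u x p : E} (hx : 0 ≤ x)
    (hp : IsLUB (Set.range fun n : ℕ => ((n : ℝ) • u) ⊓ x) p) : 0 ≤ p ∧ p ≤ x := by
  refine ⟨?_, hp.2 (by rintro _ ⟨n, rfl⟩; exact inf_le_right)⟩
  have := hp.1 ⟨0, rfl⟩
  simpa [hx] using this

lemma isLUB_inf_disjoint {u x p y : E} (hu : 0 ≤ u) (hx : 0 ≤ x) (hy : 0 ≤ y)
    (hp : IsLUB (Set.range fun n : ℕ => ((n : ℝ) • u) ⊓ x) p) (hyu : u ⊓ y = 0) :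
    p ⊓ y = 0 := by
  obtain ⟨hp0, -⟩ := isLUB_inf_bounds hx hp
  have h1 : p ≤ p - p ⊓ y := by
    refine hp.2 ?_
    rintro _ ⟨n, rfl⟩
    have hnu : 0 ≤ (n : ℝ) • u := smul_nonneg n.cast_nonneg hu
    have h2 : ((n : ℝ) • u) ⊓ x ⊓ (p ⊓ y) = 0 := by
      have := nsmul_inf_eq_zero hu hy hyu n
      rw [← Nat.cast_smul_eq_nsmul ℝ] at this
      exact inf_eq_zero_of_le this (le_inf hnu hx) (le_inf hp0 hy) inf_le_left inf_le_right
    rw [le_sub_iff_add_le, ← inf_add_sup, h2, zero_add]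
    exact sup_le (hp.1 ⟨n, rfl⟩) inf_le_left
  exact le_antisymm (by simpa using h1) (le_inf hp0 hy)

lemma isLUB_inf_sub_disjoint {u x p : E} (hu : 0 ≤ u) (hx : 0 ≤ x)
    (hp : IsLUB (Set.range fun n : ℕ => ((n : ℝ) • u) ⊓ x) p) : (x - p) ⊓ u = 0 := by
  obtain ⟨-, hpx⟩ := isLUB_inf_bounds hx hp
  have h1 : p ≤ p - (x - p) ⊓ u := by
    refine hp.2 ?_
    rintro _ ⟨n, rfl⟩
    rw [le_sub_iff_add_le]
    refine le_trans (le_inf ?_ ?_) (hp.1 ⟨n + 1, rfl⟩)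
    · push_cast
      rw [add_smul, one_smul]
      exact add_le_add inf_le_left inf_le_right
    · calc ((n : ℝ) • u) ⊓ x + (x - p) ⊓ u ≤ p + (x - p) := add_le_add (hp.1 ⟨n, rfl⟩) inf_le_left
        _ = x := by abel
  exact le_antisymm (by simpa using h1) (le_inf (sub_nonneg.2 hpx) hu)

/-- In a Dedekind complete Riesz space, every element `u ≥ 0` generates a projection band: the
space splits into `{u}ᵈᵈ` and `{u}ᵈ`, and the projection of `x ≥ 0` is `sup_n (n u ∧ x)`. -/
theorem exists_principal_orderProjection {u : E} (hu : 0 ≤ u) :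
    ∃ P : E →ₗ[ℝ] E, IsOrderProjection P ∧
      ∀ x, 0 ≤ x → IsLUB (Set.range fun n : ℕ => ((n : ℝ) • u) ⊓ x) (P x) := by
  set N : Submodule ℝ E := disjointCompl {u} with hN
  set B : Submodule ℝ E := disjointCompl (N : Set E) with hB
  have hmemN : ∀ x, x ∈ N ↔ |x| ⊓ u = 0 := by
    intro x
    rw [hN]
    change (∀ y ∈ ({u} : Set E), |x| ⊓ |y| = 0) ↔ _
    simp [abs_of_nonneg hu]
  have hmemB : ∀ x, x ∈ B ↔ ∀ y ∈ N, |x| ⊓ |y| = 0 := fun x => Iff.rfl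
  have hdec : ∀ x, 0 ≤ x → ∀ p, IsLUB (Set.range fun n : ℕ => ((n : ℝ) • u) ⊓ x) p →
      p ∈ B ∧ x - p ∈ N := by
    intro x hx p hp
    obtain ⟨hp0, hpx⟩ := isLUB_inf_bounds hx hp
    refine ⟨(hmemB p).2 fun y hy => ?_, (hmemN _).2 ?_⟩
    · rw [abs_of_nonneg hp0]
      refine isLUB_inf_disjoint hu hx (abs_nonneg y) hp ?_
      rw [inf_comm]; exact (hmemN y).1 hy
    · rw [abs_of_nonneg (sub_nonneg.2 hpx)]
      exact isLUB_inf_sub_disjoint hu hx hp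
  have hc : IsCompl B N := by
    refine ⟨Submodule.disjoint_def.2 fun x hxB hxN => ?_, codisjoint_iff.2 (eq_top_iff.2 ?_)⟩
    · have := (hmemB x).1 hxB x hxN
      rw [inf_idem] at this
      exact eq_zero_of_abs_le this.le
    · have hpos : ∀ x, 0 ≤ x → x ∈ B ⊔ N := by
        intro x hx
        obtain ⟨p, hp⟩ := exists_isLUB_inf (u := u) (x := x)
        obtain ⟨h1, h2⟩ := hdec x hx p hp
        rw [← add_sub_cancel p x]
        exact Submodule.add_mem_sup h1 h2
      intro x _
      rw [← posPart_sub_negPart x]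
      exact Submodule.sub_mem _ (hpos _ (posPart_nonneg x)) (hpos _ (negPart_nonneg x))
  have hP : ∀ x, 0 ≤ x → IsLUB (Set.range fun n : ℕ => ((n : ℝ) • u) ⊓ x)
      (B.projection N hc x) := by
    intro x hx
    obtain ⟨p, hp⟩ := exists_isLUB_inf (u := u) (x := x)
    obtain ⟨h1, h2⟩ := hdec x hx p hp
    have h3 : B.projection N hc x = p := by
      conv_lhs => rw [← add_sub_cancel p x]
      rw [map_add, Submodule.projection_apply_of_mem_left hc h1,
        (Submodule.projection_apply_eq_zero_iff hc).2 h2, add_zero]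
    rwa [h3]
  refine ⟨B.projection N hc, ⟨fun x hx => (isLUB_inf_bounds hx (hP x hx)).1,
    fun x hx => (isLUB_inf_bounds hx (hP x hx)).2, fun x => ?_⟩, hP⟩
  exact Submodule.projection_apply_of_mem_left hc (Submodule.projection_apply_mem hc x)

/-- For every `g` there is an order projection that selects the part where `g > 0`. -/
theorem exists_orderProjection_posPart (g : E) :
    ∃ P : E →ₗ[ℝ] E, IsOrderProjection P ∧ P g = g⁺ ∧
      ∀ x, 0 ≤ x → IsLUB (Set.range fun n : ℕ => ((n : ℝ) • g⁺) ⊓ x) (P x) := by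
  obtain ⟨P, hP, hlub⟩ := exists_principal_orderProjection (posPart_nonneg g)
  refine ⟨P, hP, ?_, hlub⟩
  have h1 : P g⁺ = g⁺ := by
    refine le_antisymm (hP.le_self _ (posPart_nonneg g)) ?_
    have := (hlub _ (posPart_nonneg g)).1 ⟨1, rfl⟩
    simpa using this
  have h2 : P g⁻ = 0 := by
    have h := isLUB_inf_disjoint (posPart_nonneg g) (negPart_nonneg g) (negPart_nonneg g)
      (hlub _ (negPart_nonneg g)) (posPart_inf_negPart_eq_zero g)
    rwa [inf_eq_left.2 (hP.le_self _ (negPart_nonneg g))] at h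
  conv_lhs => rw [← posPart_sub_negPart g]
  rw [map_sub, h1, h2, sub_zero]

/-! ### Order projections and conditional expectation operators -/

lemma map_mono_of_nonneg {W : E →ₗ[ℝ] E} (hW : ∀ x, 0 ≤ x → 0 ≤ W x) {x y : E} (h : x ≤ y) :
    W x ≤ W y := by
  have := hW _ (sub_nonneg.2 h)
  rwa [map_sub, sub_nonneg] at this

lemma abs_map_le_of_nonneg {W : E →ₗ[ℝ] E} (hW : ∀ x, 0 ≤ x → 0 ≤ W x) {x y : E} (h : |x| ≤ y) :
    |W x| ≤ W y := by
  refine abs_le'.2 ⟨map_mono_of_nonneg hW ((le_abs_self x).trans h), ?_⟩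
  rw [← map_neg]
  exact map_mono_of_nonneg hW ((neg_le_abs x).trans h)

lemma apply_eq_of_forall_nonneg {A B : E →ₗ[ℝ] E} (h : ∀ x, 0 ≤ x → A x = B x) (x : E) :
    A x = B x := by
  rw [← posPart_sub_negPart x, map_sub, map_sub, h _ (posPart_nonneg x), h _ (negPart_nonneg x)]

lemma le_of_apply_le {P : E →ₗ[ℝ] E} {x y : E} (h1 : P x ≤ P y) (h2 : x - P x ≤ y - P y) :
    x ≤ y := by
  simpa using add_le_add h1 h2

namespace IsOrderProjection

variable {P Q : E →ₗ[ℝ] E}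

lemma mono (hP : IsOrderProjection P) {x y : E} (h : x ≤ y) : P x ≤ P y :=
  map_mono_of_nonneg hP.nonneg h

lemma compl (hP : IsOrderProjection P) : IsOrderProjection (LinearMap.id - P) where
  nonneg x hx := by simpa using hP.le_self x hx
  le_self x hx := by simpa using hP.nonneg x hx
  idem x := by simp [hP.idem]

lemma apply_eq_self_of_le (hP : IsOrderProjection P) {x y : E} (hx : 0 ≤ x) (h : x ≤ y)
    (hy : P y = y) : P x = x := by
  refine le_antisymm (hP.le_self x hx) ?_
  have := hP.compl.mono h
  simpa [hy] using this

lemma apply_eq_zero_of_le (hP : IsOrderProjection P) {x y : E} (hx : 0 ≤ x) (h : x ≤ y)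
    (hy : P y = 0) : P x = 0 :=
  le_antisymm (hy ▸ hP.mono h) (hP.nonneg x hx)

lemma inf_compl_eq_zero (hP : IsOrderProjection P) {x y : E} (hx : 0 ≤ x) (hy : 0 ≤ y) :
    P x ⊓ (y - P y) = 0 := by
  have h0 : 0 ≤ P x ⊓ (y - P y) := le_inf (hP.nonneg x hx) (sub_nonneg.2 (hP.le_self y hy))
  rw [← hP.apply_eq_self_of_le h0 inf_le_left (hP.idem x)]
  exact hP.apply_eq_zero_of_le h0 inf_le_right (by simp [hP.idem])

lemma apply_posPart_eq_zero (hP : IsOrderProjection P) {x : E} (h : P x ≤ 0) : P x⁺ = 0 := by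
  refine le_antisymm ?_ (hP.nonneg _ (posPart_nonneg x))
  have h1 : P x⁺ ≤ P x⁻ := by
    rwa [← posPart_sub_negPart x, map_sub, sub_nonpos] at h
  rw [← posPart_inf_negPart_eq_zero x]
  exact le_inf (hP.le_self _ (posPart_nonneg x)) (h1.trans (hP.le_self _ (negPart_nonneg x)))

lemma commute (hP : IsOrderProjection P) (hQ : IsOrderProjection Q) (x : E) :
    P (Q x) = Q (P x) := by
  have key : ∀ {P : E →ₗ[ℝ] E}, IsOrderProjection P → ∀ x, P (Q (P x)) = Q (P x) := by
    intro P hP x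
    refine apply_eq_of_forall_nonneg (A := P ∘ₗ Q ∘ₗ P) (B := Q ∘ₗ P) (fun x hx => ?_) x
    exact hP.apply_eq_self_of_le (hQ.nonneg _ (hP.nonneg x hx)) (hQ.le_self _ (hP.nonneg x hx))
      (hP.idem x)
  have h := key hP.compl x
  have h' := key hP x
  simp only [LinearMap.sub_apply, LinearMap.id_apply, map_sub] at h
  rw [h', sub_self, sub_zero, sub_right_inj] at h
  exact h

lemma comp (hP : IsOrderProjection P) (hQ : IsOrderProjection Q) :
    IsOrderProjection (P ∘ₗ Q) where
  nonneg x hx := hP.nonneg _ (hQ.nonneg x hx)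
  le_self x hx := (hP.le_self _ (hQ.nonneg x hx)).trans (hQ.le_self x hx)
  idem x := by
    simp only [LinearMap.comp_apply]
    rw [← hP.commute hQ (Q x), hP.idem, hQ.idem]

lemma isBandProjection (hP : IsOrderProjection P) : IsBandProjection P := by
  have habs : ∀ x, |P x| ≤ P |x| := fun x => abs_map_le_of_nonneg hP.nonneg le_rfl
  have habs' : ∀ x, |x - P x| ≤ |x| - P |x| := fun x => by
    have := abs_map_le_of_nonneg hP.compl.nonneg (le_refl |x|)
    simpa using this
  refine ⟨LinearMap.range P, ⟨?_, ?_⟩, fun x => ⟨⟨x, rfl⟩, ?_⟩⟩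
  · rintro _ ⟨x, rfl⟩ y hy
    refine ⟨y, ?_⟩
    have h1 : P |y| = |y| := hP.apply_eq_self_of_le (abs_nonneg y) (hy.trans (habs x)) (hP.idem _)
    have h2 := habs' y
    rw [h1, sub_self] at h2
    exact (sub_eq_zero.1 (eq_zero_of_abs_le h2)).symm
  · rintro S ⟨x₀, hx₀⟩ hS s hs
    have hfix : ∀ x ∈ S, P x = x := fun x hx => by
      obtain ⟨z, rfl⟩ := hS hx
      exact hP.idem z
    refine ⟨s, le_antisymm ?_ (hs.2 fun x hx => ?_)⟩
    · have h1 := hP.le_self _ (sub_nonneg.2 (hs.1 hx₀))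
      rw [map_sub, hfix x₀ hx₀] at h1
      simpa using h1
    · rw [← hfix x hx]
      exact hP.mono (hs.1 hx)
  · rintro _ ⟨y, rfl⟩
    rw [inf_comm]
    exact inf_eq_zero_of_le (hP.inf_compl_eq_zero (abs_nonneg y) (abs_nonneg x)) (abs_nonneg _)
      (abs_nonneg _) (habs y) (habs' x)

end IsOrderProjection

lemma IsBandProjection.abs_apply_le {Q : E →ₗ[ℝ] E} (hQ : IsBandProjection Q) (x : E) :
    |Q x| ≤ |x| := by
  obtain ⟨B, -, hB⟩ := hQ
  have hd := (hB x).2 (Q x) (hB x).1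
  have h1 : |Q x| ≤ |x| + |x - Q x| := by
    have := abs_add_le x (-(x - Q x))
    rw [abs_neg] at this
    simpa using this
  calc |Q x| = (|x| + |x - Q x|) ⊓ |Q x| := (inf_eq_right.2 h1).symm
    _ ≤ |x| ⊓ |Q x| + |x - Q x| ⊓ |Q x| := add_inf_le (abs_nonneg _) (abs_nonneg _) (abs_nonneg _)
    _ ≤ |x| := by rw [hd, add_zero]; exact inf_le_left

namespace IsCondExp

variable {T : E →ₗ[ℝ] E}

lemma mono (hT : IsCondExp T) {x y : E} (h : x ≤ y) : T x ≤ T y :=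
  map_mono_of_nonneg hT.nonneg h

lemma apply_of_mem_range (hT : IsCondExp T) {x : E} (hx : x ∈ LinearMap.range T) : T x = x := by
  obtain ⟨y, rfl⟩ := hx
  exact hT.idem y

lemma inf_mem_range (hT : IsCondExp T) {x y : E} (hx : x ∈ LinearMap.range T)
    (hy : y ∈ LinearMap.range T) : x ⊓ y ∈ LinearMap.range T := by
  have := neg_mem (hT.sup_mem_range _ (neg_mem hx) _ (neg_mem hy))
  rwa [neg_sup, neg_neg, neg_neg] at this

lemma posPart_mem_range (hT : IsCondExp T) {x : E} (hx : x ∈ LinearMap.range T) :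
    x⁺ ∈ LinearMap.range T :=
  hT.sup_mem_range _ hx _ (zero_mem _)

/-- The range of a conditional expectation operator is closed under suprema taken in `E`. -/
lemma mem_range_of_isLUB (hT : IsCondExp T) {S : Set E} (hS : S.Nonempty)
    (hST : S ⊆ LinearMap.range T) {s : E} (hs : IsLUB S s) : s ∈ LinearMap.range T := by
  -- Passing to finite suprema, the set becomes directed and order continuity applies.
  have hlub : IsLUB (supClosure S) s := isLUB_supClosure.2 hs
  have hsub : supClosure S ⊆ LinearMap.range T :=
    supClosure_min hST fun x hx y hy => hT.sup_mem_range x hx y hy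
  have hdir : DirectedOn (· ≤ ·) (supClosure S) := supClosed_supClosure.directedOn
  have hne : (supClosure S).Nonempty := hS.mono subset_supClosure
  have hglb := hT.orderContinuous ((fun x => s - x) '' supClosure S) (hne.image _) (by
    rintro _ ⟨x, hx, rfl⟩ _ ⟨y, hy, rfl⟩
    obtain ⟨z, hz, hxz, hyz⟩ := hdir x hx y hy
    exact ⟨s - z, ⟨z, hz, rfl⟩, sub_le_sub_left hxz s, sub_le_sub_left hyz s⟩) (by
    constructor
    · rintro _ ⟨x, hx, rfl⟩
      exact sub_nonneg.2 (hlub.1 hx)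
    · intro w hw
      have : s ≤ s - w := hlub.2 fun x hx => by
        have := hw ⟨x, hx, rfl⟩
        exact le_sub_comm.1 this
      simpa using this)
  have hge : s ≤ T s := hlub.2 fun x hx => by
    rw [← hT.apply_of_mem_range (hsub hx)]
    exact hT.mono (hlub.1 hx)
  have hle : T s - s ≤ 0 := by
    refine hglb.2 ?_
    rintro _ ⟨_, ⟨x, hx, rfl⟩, rfl⟩
    simp only [map_sub, hT.apply_of_mem_range (hsub hx)]
    exact sub_le_sub_left (hlub.1 hx) _
  exact ⟨s, le_antisymm (sub_nonpos.1 hle) hge⟩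

lemma mem_range_of_isGLB (hT : IsCondExp T) {S : Set E} (hS : S.Nonempty)
    (hST : S ⊆ LinearMap.range T) {s : E} (hs : IsGLB S s) : s ∈ LinearMap.range T := by
  rw [← neg_neg s]
  refine neg_mem (hT.mem_range_of_isLUB (S := -S) hS.neg (fun x hx => ?_) hs.neg)
  rw [← neg_neg x]
  exact neg_mem (hST hx)

/-- For `e` and `g` in the range of a conditional expectation operator, the order projection onto
the band generated by `g⁺` maps `e` into that range, since it maps `e` to `sup_n (n g⁺ ∧ e)`. -/
lemma exists_orderProjection (hT : IsCondExp T) {e g : E} (he : 0 ≤ e)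
    (heT : e ∈ LinearMap.range T) (hg : g ∈ LinearMap.range T) :
    ∃ P : E →ₗ[ℝ] E, IsOrderProjection P ∧ P e ∈ LinearMap.range T ∧ P g = g⁺ ∧
      (g ≤ 0 → P = 0) := by
  obtain ⟨P, hP, hPg, hlub⟩ := exists_orderProjection_posPart g
  refine ⟨P, hP, hT.mem_range_of_isLUB (Set.range_nonempty _) ?_ (hlub e he), hPg, fun h => ?_⟩
  · rintro _ ⟨n, rfl⟩
    exact hT.inf_mem_range (Submodule.smul_mem _ _ (hT.posPart_mem_range hg)) heT
  · refine LinearMap.ext fun x => apply_eq_of_forall_nonneg (fun x hx => ?_) x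
    refine (hlub x hx).unique ?_
    simp [posPart_eq_zero.2 h, hx]

end IsCondExp

/-- The truncations `x ∧ n e` by a weak order unit `e` increase to `x`. -/
lemma IsWeakOrderUnit.isGLB_sub_inf {e x : E} (he : IsWeakOrderUnit e) (hx : 0 ≤ x) :
    IsGLB (Set.range fun n : ℕ => x - x ⊓ ((n : ℝ) • e)) 0 := by
  constructor
  · rintro _ ⟨n, rfl⟩
    exact sub_nonneg.2 inf_le_left
  · intro w hw
    suffices h : w⁺ = 0 from posPart_eq_zero.1 h
    refine he.2 _ ?_
    rw [abs_of_nonneg (posPart_nonneg w)]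
    refine le_antisymm ?_ (le_inf he.1 (posPart_nonneg w))
    refine le_zero_of_forall_nat_smul_le (y := x) fun n => ?_
    -- `w⁺` lives where `x > n e`, so `n (e ∧ w⁺) ≤ x` there.
    obtain ⟨P, hP, hPg, -⟩ := exists_orderProjection_posPart (x - (n : ℝ) • e)
    have h1 : w⁺ ≤ (x - (n : ℝ) • e)⁺ := by
      have h2 : x - x ⊓ ((n : ℝ) • e) = (x - (n : ℝ) • e)⁺ := by
        rw [posPart_def, sub_eq_add_neg, neg_inf, add_sup, ← sub_eq_add_neg, ← sub_eq_add_neg,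
          sub_self, sup_comm]
      rw [← h2]
      exact sup_le_iff.2 ⟨hw ⟨n, rfl⟩, sub_nonneg.2 inf_le_left⟩
    have h3 : P (x - (n : ℝ) • e)⁺ = (x - (n : ℝ) • e)⁺ := by rw [← hPg, hP.idem]
    have h0 : 0 ≤ e ⊓ w⁺ := le_inf he.1 (posPart_nonneg w)
    have h4 : P (e ⊓ w⁺) = e ⊓ w⁺ := hP.apply_eq_self_of_le h0 (inf_le_right.trans h1) h3
    have h5 : (n : ℝ) • P e ≤ P x := by
      have := hPg ▸ posPart_nonneg (x - (n : ℝ) • e)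
      rwa [map_sub, map_smul, sub_nonneg] at this
    calc (n : ℝ) • (e ⊓ w⁺) = (n : ℝ) • P (e ⊓ w⁺) := by rw [h4]
      _ ≤ (n : ℝ) • P e := smul_le_smul_of_nonneg_left (hP.mono inf_le_left) n.cast_nonneg
      _ ≤ P x := h5
      _ ≤ x := hP.le_self x hx

/-- The averaging property: an order projection `R` with `R e ∈ R(U)` commutes with the
conditional expectation operator `U`. For `0 ≤ y ≤ n e` this follows from `U (R y) ≤ n R e`, and the
truncations `x ∧ n e` together with order continuity extend it to all `x ≥ 0`. -/
theorem IsCondExp.commute {U R : E →ₗ[ℝ] E} {e : E} (hU : IsCondExp U) (he : IsWeakOrderUnit e)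
    (heU : e ∈ LinearMap.range U) (hR : IsOrderProjection R) (hRe : R e ∈ LinearMap.range U)
    (x : E) : U (R x) = R (U x) := by
  have key : ∀ {R : E →ₗ[ℝ] E}, IsOrderProjection R → R e ∈ LinearMap.range U →
      ∀ x, R (U (R x)) = U (R x) := by
    intro R hR hRe x
    refine apply_eq_of_forall_nonneg (A := R ∘ₗ U ∘ₗ R) (B := U ∘ₗ R) (fun x hx => ?_) x
    simp only [LinearMap.comp_apply]
    refine le_antisymm (hR.le_self _ (hU.nonneg _ (hR.nonneg x hx))) (sub_nonpos.1 ?_)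
    have hglb := hU.orderContinuous _ (Set.range_nonempty _) (by
      rintro _ ⟨n, rfl⟩ _ ⟨m, rfl⟩
      have hmono : ∀ {i j : ℕ}, i ≤ j → x - x ⊓ ((j : ℝ) • e) ≤ x - x ⊓ ((i : ℝ) • e) :=
        fun hij => sub_le_sub_left (inf_le_inf_left _
          (smul_le_smul_of_nonneg_right (Nat.cast_le.2 hij) he.1)) _
      exact ⟨_, ⟨max n m, rfl⟩, hmono (le_max_left _ _), hmono (le_max_right _ _)⟩)
      (he.isGLB_sub_inf hx)
    refine hglb.2 ?_
    rintro _ ⟨_, ⟨n, rfl⟩, rfl⟩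
    set y := x ⊓ ((n : ℝ) • e) with hy
    have hy0 : 0 ≤ y := le_inf hx (smul_nonneg n.cast_nonneg he.1)
    have hxy : 0 ≤ x - y := sub_nonneg.2 inf_le_left
    have h1 : R (U (R y)) = U (R y) := by
      refine hR.apply_eq_self_of_le (hU.nonneg _ (hR.nonneg y hy0)) (y := (n : ℝ) • R e) ?_
        (by rw [map_smul, hR.idem])
      rw [← hU.apply_of_mem_range hRe, ← map_smul, ← map_smul]
      exact hU.mono (hR.mono inf_le_right)
    calc U (R x) - R (U (R x)) = U (R (x - y)) - R (U (R (x - y))) := by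
          simp only [map_sub, h1]; abel
      _ ≤ U (R (x - y)) := sub_le_self _ (hR.nonneg _ (hU.nonneg _ (hR.nonneg _ hxy)))
      _ ≤ U (x - y) := hU.mono (hR.le_self _ hxy)
  have h := key hR.compl (by simpa using sub_mem heU hRe) x
  have h' := key hR hRe x
  simp only [LinearMap.sub_apply, LinearMap.id_apply, map_sub] at h
  rw [h', sub_self, sub_zero, sub_right_inj] at h
  exact h.symm

/-! ### Step functions and localization -/

variable {P : E →ₗ[ℝ] E} {e g : E}

lemma smul_apply_le_of_posPart {c : ℝ}
    (hPg : P (g - c • e) = (g - c • e)⁺) : c • P e ≤ P g := by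
  have := hPg ▸ posPart_nonneg (g - c • e)
  rwa [map_sub, map_smul, sub_nonneg] at this

lemma sub_apply_le_of_posPart {c : ℝ}
    (hPg : P (g - c • e) = (g - c • e)⁺) : g - P g ≤ c • (e - P e) := by
  have h := le_posPart (g - c • e)
  rw [← hPg, map_sub, map_smul] at h
  rw [← sub_nonneg] at h ⊢
  convert h using 1
  rw [smul_sub]
  abel

namespace IsOrderProjection

/-- On the part where `g > b e`, the slice of `g` between heights `a ≤ b` is full. -/
lemma smul_apply_add_inf_le (hP : IsOrderProjection P) (he : 0 ≤ e) {a b : ℝ} (hab : a ≤ b)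
    (hPg : P (g - b • e) = (g - b • e)⁺) :
    (b - a) • P e + g ⊓ (a • e) ≤ g ⊓ (b • e) := by
  refine le_inf (le_of_apply_le (P := P) ?_ ?_) ?_
  · calc P ((b - a) • P e + g ⊓ (a • e)) = (b - a) • P e + P (g ⊓ (a • e)) := by
          rw [map_add, map_smul, hP.idem]
      _ ≤ (b - a) • P e + P (a • e) := add_le_add_right (hP.mono inf_le_right) _
      _ = b • P e := by rw [map_smul]; module
      _ ≤ P g := smul_apply_le_of_posPart hPg
  · calc (b - a) • P e + g ⊓ (a • e) - P ((b - a) • P e + g ⊓ (a • e))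
        = (g ⊓ (a • e)) - P (g ⊓ (a • e)) := by
          rw [map_add, map_smul, hP.idem]; abel
      _ ≤ g - P g := by
          simpa using hP.compl.mono (inf_le_left (a := g) (b := a • e))
  · calc (b - a) • P e + g ⊓ (a • e) ≤ (b - a) • e + a • e :=
          add_le_add (smul_le_smul_of_nonneg_left (hP.le_self e he) (sub_nonneg.2 hab)) inf_le_right
      _ = b • e := by module

/-- Outside the part where `g > a e`, the slice of `g` between heights `a ≤ b` is empty. -/
lemma inf_le_smul_apply_add (hP : IsOrderProjection P) (he : 0 ≤ e) {a b : ℝ} (hab : a ≤ b)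
    (hPg : P (g - a • e) = (g - a • e)⁺) :
    g ⊓ (b • e) ≤ (b - a) • P e + g ⊓ (a • e) := by
  rw [add_inf]
  refine le_inf (inf_le_left.trans (le_add_of_nonneg_left
    (smul_nonneg (sub_nonneg.2 hab) (hP.nonneg e he)))) (le_of_apply_le (P := P) ?_ ?_)
  · calc P (g ⊓ (b • e)) ≤ P (b • e) := hP.mono inf_le_right
      _ = P ((b - a) • P e + a • e) := by
          rw [map_add, map_smul, map_smul, map_smul, hP.idem]; module
  · calc g ⊓ (b • e) - P (g ⊓ (b • e)) ≤ g - P g := by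
          simpa using hP.compl.mono (inf_le_left (a := g) (b := b • e))
      _ ≤ a • (e - P e) := sub_apply_le_of_posPart hPg
      _ = (b - a) • P e + a • e - P ((b - a) • P e + a • e) := by
          rw [map_add, map_smul, map_smul, hP.idem, smul_sub]; abel

end IsOrderProjection

/-- Approximation by step functions: if `0 ≤ g ≤ n δ e` with `g` in the range of the conditional
expectation operator `V`, then `g` is within `δ e` of `∑ δ Q_k e`, where `Q_k` selects the part
where `g > k δ e`. -/
theorem IsCondExp.exists_step_approx {V : E →ₗ[ℝ] E} {e g : E} (hV : IsCondExp V) (he : 0 ≤ e)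
    (heV : e ∈ LinearMap.range V) (hg : g ∈ LinearMap.range V) (hg0 : 0 ≤ g) {δ : ℝ} (hδ : 0 ≤ δ)
    (n : ℕ) (hgn : g ≤ ((n : ℝ) * δ) • e) :
    ∃ Q : ℕ → E →ₗ[ℝ] E, (∀ k, IsOrderProjection (Q k) ∧ Q k e ∈ LinearMap.range V) ∧
      0 ≤ (∑ k ∈ Finset.range n, δ • Q k e) - g ∧
      (∑ k ∈ Finset.range n, δ • Q k e) - g ≤ δ • e := by
  choose Q hQ hQe hQg _ using fun k : ℕ => hV.exists_orderProjection he heV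
    (sub_mem hg (Submodule.smul_mem _ ((k : ℝ) * δ) heV))
  have hstep : ∀ k : ℕ, (k : ℝ) * δ ≤ ((k + 1 : ℕ) : ℝ) * δ := fun k =>
    mul_le_mul_of_nonneg_right (Nat.cast_le.2 k.le_succ) hδ
  have hdiff : ∀ k : ℕ, ((k + 1 : ℕ) : ℝ) * δ - (k : ℝ) * δ = δ := fun k => by push_cast; ring
  have htel : g = ∑ k ∈ Finset.range n,
      (g ⊓ ((((k + 1 : ℕ) : ℝ) * δ) • e) - g ⊓ (((k : ℝ) * δ) • e)) := by
    rw [Finset.sum_range_sub (fun k : ℕ => g ⊓ (((k : ℝ) * δ) • e)) n, inf_eq_left.2 hgn]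
    simp [hg0]
  refine ⟨Q, fun k => ⟨hQ k, hQe k⟩, ?_, ?_⟩
  · rw [sub_nonneg]
    conv_lhs => rw [htel]
    refine Finset.sum_le_sum fun k _ => ?_
    have := (hQ k).inf_le_smul_apply_add he (hstep k) (hQg k)
    rw [hdiff] at this
    exact sub_le_iff_le_add.2 this
  · have hlow : ∑ k ∈ Finset.range n, δ • Q (k + 1) e ≤ g := by
      conv_rhs => rw [htel]
      refine Finset.sum_le_sum fun k _ => ?_
      have := (hQ (k + 1)).smul_apply_add_inf_le he (hstep k) (hQg (k + 1))
      rw [hdiff] at this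
      exact le_sub_iff_add_le.2 this
    have hsum : ∑ k ∈ Finset.range n, δ • Q k e - ∑ k ∈ Finset.range n, δ • Q (k + 1) e
        = δ • Q 0 e - δ • Q n e := by
      rw [← Finset.sum_sub_distrib, Finset.sum_range_sub' (fun k => δ • Q k e) n]
    calc ∑ k ∈ Finset.range n, δ • Q k e - g
        ≤ ∑ k ∈ Finset.range n, δ • Q k e - ∑ k ∈ Finset.range n, δ • Q (k + 1) e :=
          sub_le_sub_left hlow _
      _ = δ • Q 0 e - δ • Q n e := hsum
      _ ≤ δ • Q 0 e := sub_le_self _ (smul_nonneg hδ ((hQ n).nonneg e he))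
      _ ≤ δ • e := smul_le_smul_of_nonneg_left ((hQ 0).le_self e he) hδ

lemma abs_sum_le_sum {ι : Type*} (s : Finset ι) (f : ι → E) :
    |∑ i ∈ s, f i| ≤ ∑ i ∈ s, |f i| :=
  Finset.le_sum_of_subadditive _ (by simp) abs_add_le s f

/-- A bound for `|UQe - TQe|` that is uniform over the order projections `Q` with `Q e ∈ R(V)`
passes to the elements of `R(V)` between `0` and `t e`. -/
theorem abs_sub_le_of_nonneg_of_le_smul {T U V : E →ₗ[ℝ] E} {e c g : E}
    (hT : ∀ x, 0 ≤ x → 0 ≤ T x) (hTe : T e = e) (hU : ∀ x, 0 ≤ x → 0 ≤ U x) (hUe : U e = e)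
    (hV : IsCondExp V) (he : 0 ≤ e) (heV : e ∈ LinearMap.range V)
    (hc : ∀ Q, IsOrderProjection Q → Q e ∈ LinearMap.range V → |U (Q e) - T (Q e)| ≤ c)
    (hg : g ∈ LinearMap.range V) (hg0 : 0 ≤ g) {t : ℝ} (ht : 0 ≤ t) (hgt : g ≤ t • e) :
    |U g - T g| ≤ t • c := by
  refine le_of_forall_nat_smul_sub_le (z := t • e) fun n => ?_
  rcases n.eq_zero_or_pos with rfl | hn
  · simpa using smul_nonneg ht he
  have hn' : (n : ℝ) ≠ 0 := by positivity
  have hδ : 0 ≤ t / n := by positivity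
  obtain ⟨Q, hQ, hr0, hr1⟩ := hV.exists_step_approx he heV hg hg0 hδ n
    (by rwa [mul_div_cancel₀ _ hn'])
  set r := (∑ k ∈ Finset.range n, (t / n) • Q k e) - g with hr
  have hgr : U g - T g = (∑ k ∈ Finset.range n, (t / n) • (U (Q k e) - T (Q k e)))
      - (U r - T r) := by
    simp only [hr, map_sub, map_sum, map_smul, smul_sub, Finset.sum_sub_distrib]
    abel
  have hrest : |U r - T r| ≤ (t / n) • e := by
    have hUr : U r ≤ (t / n) • e := by
      simpa [hUe] using map_mono_of_nonneg hU hr1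
    have hTr : T r ≤ (t / n) • e := by
      simpa [hTe] using map_mono_of_nonneg hT hr1
    refine abs_le'.2 ⟨(sub_le_self _ (hT r hr0)).trans hUr, ?_⟩
    rw [neg_sub]
    exact (sub_le_self _ (hU r hr0)).trans hTr
  have hmain : |U g - T g| ≤ t • c + (t / n) • e := by
    rw [hgr, sub_eq_add_neg]
    refine (abs_add_le _ _).trans (add_le_add ?_ (by rwa [abs_neg]))
    calc |∑ k ∈ Finset.range n, (t / n) • (U (Q k e) - T (Q k e))|
        ≤ ∑ k ∈ Finset.range n, |(t / n) • (U (Q k e) - T (Q k e))| := abs_sum_le_sum _ _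
      _ ≤ ∑ k ∈ Finset.range n, (t / n) • c := Finset.sum_le_sum fun k _ => by
          refine (abs_smul_le _ _).trans ?_
          rw [abs_of_nonneg hδ]
          exact smul_le_smul_of_nonneg_left (hc _ (hQ k).1 (hQ k).2) hδ
      _ = t • c := by
          rw [Finset.sum_const, Finset.card_range, ← Nat.cast_smul_eq_nsmul ℝ, smul_smul,
            mul_div_cancel₀ _ hn']
  calc (n : ℝ) • (|U g - T g| - t • c) ≤ (n : ℝ) • ((t / n) • e) :=
        smul_le_smul_of_nonneg_left (sub_le_iff_le_add'.2 hmain) n.cast_nonneg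
    _ = t • e := by rw [smul_smul, mul_div_cancel₀ _ hn']

/-- The same for elements of `R(V)` that are not positive, at the price of a factor `2`: the
positive and the negative part are treated separately. -/
theorem abs_sub_le_of_abs_le_smul {T U V : E →ₗ[ℝ] E} {e c g : E}
    (hT : ∀ x, 0 ≤ x → 0 ≤ T x) (hTe : T e = e) (hU : ∀ x, 0 ≤ x → 0 ≤ U x) (hUe : U e = e)
    (hV : IsCondExp V) (he : 0 ≤ e) (heV : e ∈ LinearMap.range V)
    (hc : ∀ Q, IsOrderProjection Q → Q e ∈ LinearMap.range V → |U (Q e) - T (Q e)| ≤ c)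
    (hg : g ∈ LinearMap.range V) {t : ℝ} (ht : 0 ≤ t) (hgt : |g| ≤ t • e) :
    |U g - T g| ≤ (2 * t) • c := by
  have h1 := abs_sub_le_of_nonneg_of_le_smul hT hTe hU hUe hV he heV hc
    (hV.posPart_mem_range hg) (posPart_nonneg g) ht
    ((sup_le (le_abs_self g) (abs_nonneg g)).trans hgt)
  have h2 := abs_sub_le_of_nonneg_of_le_smul hT hTe hU hUe hV he heV hc
    (hV.posPart_mem_range (neg_mem hg)) (posPart_nonneg (-g)) ht
    ((sup_le (neg_le_abs g) (abs_nonneg g)).trans hgt)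
  rw [posPart_neg] at h2
  calc |U g - T g| = |(U g⁺ - T g⁺) + -(U g⁻ - T g⁻)| := by
        conv_lhs => rw [← posPart_sub_negPart g]
        rw [map_sub, map_sub]
        congr 1
        abel
    _ ≤ t • c + t • c := (abs_add_le _ _).trans (add_le_add h1 (by rwa [abs_neg]))
    _ = (2 * t) • c := by module

/-- Localization: an inequality `x ≤ y` may be checked on the parts where `a` lies between two
consecutive multiples of `δ e`, for any `a ≥ 0` in the range of `T`. -/
theorem IsCondExp.le_of_forall_orderProjection {T : E →ₗ[ℝ] E} {e a x y : E} (hT : IsCondExp T)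
    (he : IsWeakOrderUnit e) (heT : e ∈ LinearMap.range T) (ha : a ∈ LinearMap.range T)
    (ha0 : 0 ≤ a) {δ : ℝ} (hδ : 0 < δ)
    (h : ∀ P : E →ₗ[ℝ] E, IsOrderProjection P → P e ∈ LinearMap.range T →
      ∀ k : ℕ, ((k : ℝ) * δ) • P e ≤ P a → P a ≤ (((k : ℝ) + 1) * δ) • P e → P x ≤ P y) :
    x ≤ y := by
  -- `N k` selects the part where `a < k δ e`.
  choose N hN hNe hNa hN0 using fun k : ℕ => hT.exists_orderProjection he.1 heT
    (sub_mem (Submodule.smul_mem _ ((k : ℝ) * δ) heT) ha)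
  set z := (x - y)⁺ with hz
  have hz0 : 0 ≤ z := posPart_nonneg _
  have hupper : ∀ k, N k a ≤ ((k : ℝ) * δ) • N k e := fun k => by
    have := hNa k ▸ posPart_nonneg (((k : ℝ) * δ) • e - a)
    rwa [map_sub, map_smul, sub_nonneg] at this
  have hlower : ∀ k : ℕ, ((k : ℝ) * δ) • (e - N k e) ≤ a - N k a := fun k => by
    have := le_posPart (((k : ℝ) * δ) • e - a)
    rw [← hNa k, map_sub, map_smul, ← sub_nonneg] at this
    rw [← sub_nonneg]
    convert this using 1
    rw [smul_sub]
    abel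
  have hNz : ∀ k, N k z = 0 := by
    intro k
    -- By induction, `z` vanishes where `a < k δ e`: the next slice is covered by the hypothesis.
    induction k with
    | zero =>
      rw [hN0 0 (by simpa using ha0)]
      rfl
    | succ k ih =>
      have hP := (hN (k + 1)).comp (hN k).compl
      have hPv : ∀ v, (N (k + 1) ∘ₗ (LinearMap.id - N k)) v = N (k + 1) (v - N k v) := fun v => rfl
      have hPz := hP.apply_posPart_eq_zero (x := x - y) (by
        rw [map_sub, sub_nonpos]
        refine h _ hP ?_ k ?_ ?_
        · -- the projection of `e` is the infimum of two elements of the range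
          have heq : (N (k + 1) ∘ₗ (LinearMap.id - N k)) e = N (k + 1) e ⊓ (e - N k e) := by
            rw [hPv]
            refine le_antisymm (le_inf ((hN (k + 1)).mono (sub_le_self _ ((hN k).nonneg e he.1)))
              ((hN (k + 1)).le_self _ (sub_nonneg.2 ((hN k).le_self e he.1)))) ?_
            have hk0 : 0 ≤ N (k + 1) e ⊓ (e - N k e) :=
              le_inf ((hN (k + 1)).nonneg e he.1) (sub_nonneg.2 ((hN k).le_self e he.1))
            rw [← (hN (k + 1)).apply_eq_self_of_le hk0 inf_le_left ((hN (k + 1)).idem e)]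
            exact (hN (k + 1)).mono inf_le_right
          rw [heq]
          exact hT.inf_mem_range (hNe (k + 1)) (sub_mem heT (hNe k))
        · rw [hPv, hPv, ← map_smul]
          exact (hN (k + 1)).mono (hlower k)
        · rw [hPv, hPv]
          have hcomm : ∀ v, N (k + 1) (v - N k v) = N (k + 1) v - N k (N (k + 1) v) := fun v => by
            rw [map_sub, (hN (k + 1)).commute (hN k)]
          rw [hcomm, hcomm]
          have := (hN k).compl.mono (hupper (k + 1))
          push_cast at this
          simpa [smul_sub] using this)
      rw [hPv, ← hz, ih, sub_zero] at hPz
      exact hPz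
  have hze : e ⊓ |z| = 0 := by
    rw [abs_of_nonneg hz0]
    have h0 : 0 ≤ e ⊓ z := le_inf he.1 hz0
    refine le_antisymm ?_ h0
    have hδz : δ • (e ⊓ z) ≤ 0 := by
      refine le_zero_of_forall_nat_smul_le (y := a) fun k => ?_
      have hk : e ⊓ z ≤ e - N k e := by
        have h1 : N k (e ⊓ z) = 0 := (hN k).apply_eq_zero_of_le h0 inf_le_right (hNz k)
        have h2 := (hN k).compl.mono (inf_le_left (a := e) (b := z))
        simpa [h1] using h2
      calc (k : ℝ) • δ • (e ⊓ z) = ((k : ℝ) * δ) • (e ⊓ z) := smul_smul _ _ _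
        _ ≤ ((k : ℝ) * δ) • (e - N k e) := smul_le_smul_of_nonneg_left hk (by positivity)
        _ ≤ a - N k a := hlower k
        _ ≤ a := sub_le_self _ ((hN k).nonneg a ha0)
    have := smul_le_smul_of_nonneg_left hδz (inv_nonneg.2 hδ.le)
    rwa [smul_zero, smul_smul, inv_mul_cancel₀ hδ.ne', one_smul] at this
  exact sub_nonpos.1 (posPart_eq_zero.1 (he.2 z hze))

/-! ### The mixing inequality -/

section NormInfty

variable {T : E →ₗ[ℝ] E} {f g : E}

lemma isGLB_normInfty (hf : f ∈ LInfty T) : IsGLB (rangeBounds T f) (normInfty T f) :=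
  isGLB_csInf hf ⟨0, fun _ hg => hg.2.1⟩

lemma normInfty_nonneg (hf : f ∈ LInfty T) : 0 ≤ normInfty T f :=
  (isGLB_normInfty hf).2 fun _ hg => hg.2.1

lemma abs_le_normInfty (hf : f ∈ LInfty T) : |f| ≤ normInfty T f :=
  (isGLB_normInfty hf).2 fun _ hg => hg.2.2

lemma normInfty_le (hg : g ∈ rangeBounds T f) : normInfty T f ≤ g :=
  (isGLB_normInfty ⟨g, hg⟩).1 hg

lemma IsCondExp.normInfty_mem_range (hT : IsCondExp T) (hf : f ∈ LInfty T) :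
    normInfty T f ∈ LinearMap.range T :=
  hT.mem_range_of_isGLB hf (fun _ hg => hg.1) (isGLB_normInfty hf)

lemma IsCondExp.norm1_le_normInfty (hT : IsCondExp T) (hf : f ∈ LInfty T) :
    norm1 T f ≤ normInfty T f := by
  rw [norm1, ← hT.apply_of_mem_range (hT.normInfty_mem_range hf)]
  exact hT.mono (abs_le_normInfty hf)

lemma IsCompatible.range_le {U : E →ₗ[ℝ] E} (h : IsCompatible T U) :
    LinearMap.range T ≤ LinearMap.range U := by
  rintro _ ⟨x, rfl⟩
  exact ⟨T x, h.2 x⟩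

/-- `2 g` bounds `U f - T f` when `g ∈ R(T)₊` bounds `f`. -/
lemma two_smul_mem_rangeBounds {U : E →ₗ[ℝ] E} (hT : IsCondExp T) (hU : IsCondExp U)
    (hTU : IsCompatible T U) (hg : g ∈ rangeBounds T f) :
    (2 : ℝ) • g ∈ rangeBounds T (U f - T f) := by
  obtain ⟨hgT, hg0, hfg⟩ := hg
  refine ⟨Submodule.smul_mem _ _ hgT, smul_nonneg zero_le_two hg0, ?_⟩
  have h1 := abs_map_le_of_nonneg hT.nonneg hfg
  have h2 := abs_map_le_of_nonneg hU.nonneg hfg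
  rw [hT.apply_of_mem_range hgT] at h1
  rw [hU.apply_of_mem_range (hTU.range_le hgT)] at h2
  rw [sub_eq_add_neg, two_smul]
  exact (abs_add_le _ _).trans (add_le_add h2 (by rwa [abs_neg]))

end NormInfty

/-- The products `s t p` that define `a · b` are bounded as soon as `a` is bounded by a multiple
of the unit `e`. -/
lemma bddAbove_mulSet {e a b : E} {c : ℝ} (ha : a ≤ c • e) (hb : 0 ≤ b) :
    BddAbove (mulSet e a b) := by
  refine ⟨(max c 0) • b, ?_⟩
  rintro _ ⟨s, t, p, hs, ht, hp, hsp, htp, rfl⟩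
  have hp0 : 0 ≤ p := hp ▸ inf_le_left
  have hep : 0 ≤ e - p := hp ▸ inf_le_right
  rcases le_or_gt s (max c 0) with hsc | hsc
  · calc (s * t) • p = s • t • p := mul_smul _ _ _
      _ ≤ s • b := smul_le_smul_of_nonneg_left htp hs
      _ ≤ (max c 0) • b := smul_le_smul_of_nonneg_right hsc hb
  · -- If `s > c`, then `s p ≤ c e` makes `p` a multiple of an element disjoint from it.
    have hd : 0 < s - max c 0 := sub_pos.2 hsc
    have h1 : (s - max c 0) • p ≤ (max c 0) • (e - p) := by
      have h2 : s • p ≤ (max c 0) • e := (hsp.trans ha).trans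
        (smul_le_smul_of_nonneg_right (le_max_left c 0) (by simpa using add_nonneg hp0 hep))
      rw [sub_smul, smul_sub]
      exact sub_le_sub_right h2 _
    have h3 : p ≤ (0 : E) := by
      obtain ⟨n, hn⟩ := exists_nat_ge ((s - max c 0)⁻¹ * max c 0)
      have h4 : p ≤ n • (e - p) := by
        have h5 := smul_le_smul_of_nonneg_left h1 (inv_nonneg.2 hd.le)
        rw [smul_smul, smul_smul, inv_mul_cancel₀ hd.ne', one_smul] at h5
        rw [← Nat.cast_smul_eq_nsmul ℝ]
        exact h5.trans (smul_le_smul_of_nonneg_right hn hep)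
      rw [← nsmul_inf_eq_zero hep hp0 (by rwa [inf_comm]) n]
      exact le_inf h4 le_rfl
    rw [le_antisymm h3 hp0, smul_zero]
    exact smul_nonneg (le_max_right _ _) hb

/-- The elements `s t p` of `mulSet e a b` whose component `p` of `e` lies in `R(T)`. Their
supremum is again in `R(T)`, which is not evident for the supremum over all components. -/
def rangeMulSet (T : E →ₗ[ℝ] E) (e a b : E) : Set E :=
  {x | ∃ (s t : ℝ) (p : E), 0 ≤ s ∧ 0 ≤ t ∧ p ∈ LinearMap.range T ∧ p ⊓ (e - p) = 0 ∧
    s • p ≤ a ∧ t • p ≤ b ∧ x = (s * t) • p}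

lemma rangeMulSet_subset (T : E →ₗ[ℝ] E) (e a b : E) : rangeMulSet T e a b ⊆ mulSet e a b := by
  rintro _ ⟨s, t, p, hs, ht, -, hp, hsp, htp, rfl⟩
  exact ⟨s, t, p, hs, ht, hp, hsp, htp, rfl⟩

lemma rangeMulSet_subset_range (T : E →ₗ[ℝ] E) (e a b : E) :
    rangeMulSet T e a b ⊆ LinearMap.range T := by
  rintro _ ⟨s, t, p, -, -, hpT, -, -, -, rfl⟩
  exact Submodule.smul_mem _ _ hpT

lemma zero_mem_rangeMulSet {T : E →ₗ[ℝ] E} {e a b : E} (he : 0 ≤ e) (ha : 0 ≤ a) (hb : 0 ≤ b) :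
    (0 : E) ∈ rangeMulSet T e a b :=
  ⟨0, 0, 0, le_rfl, le_rfl, zero_mem _, by simpa using he, by simpa using ha, by simpa using hb,
    by simp⟩

/-- The mixing inequality with the supremum `w` of `rangeMulSet` in place of the product. On a part
where `j δ ≤ c ≤ (j + 1) δ` and `k δ ≤ m ≤ (k + 1) δ`, the estimate for elements bounded by the
real multiple `(k + 1) δ` of `e` gives `|Uf - Tf| ≤ 2 (k + 1) (j + 1) δ²`, which exceeds
`2 w ≥ 2 j k δ²` by at most `2 δ (c + m + δ)`. -/
theorem abs_sub_le_two_smul {T U V : E →ₗ[ℝ] E} {e c m w f : E}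
    (hT : IsCondExp T) (he : IsWeakOrderUnit e) (hTe : T e = e)
    (hU : IsCondExp U) (hTU : IsCompatible T U) (hV : IsCondExp V) (hTV : IsCompatible T V)
    (hc : ∀ Q, IsOrderProjection Q → Q e ∈ LinearMap.range V → |U (Q e) - T (Q e)| ≤ c)
    (hc0 : 0 ≤ c) (hcT : c ∈ LinearMap.range T) (hm0 : 0 ≤ m) (hmT : m ∈ LinearMap.range T)
    (hfm : |f| ≤ m) (hf : f ∈ LinearMap.range V) (hw : w ∈ upperBounds (rangeMulSet T e c m)) :
    |U f - T f| ≤ (2 : ℝ) • w := by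
  have heT : e ∈ LinearMap.range T := ⟨e, hTe⟩
  have heU := hTU.range_le heT
  have heV := hTV.range_le heT
  have hδ : ∀ δ : ℝ, 0 < δ → |U f - T f| ≤ (2 : ℝ) • w + (2 * δ) • (c + m + δ • e) := by
    intro δ hδ
    refine hT.le_of_forall_orderProjection he heT hcT hc0 hδ fun P hP hPe j hj hj' => ?_
    refine hT.le_of_forall_orderProjection he heT hmT hm0 hδ fun P' hP' hP'e k hk hk' => ?_
    set R : E →ₗ[ℝ] E := P' ∘ₗ P with hRdef
    have hRv : ∀ v, P' (P v) = R v := fun v => rfl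
    have hRv' : ∀ v, P (P' v) = R v := fun v => hP.commute hP' v
    have hR : IsOrderProjection R := hP'.comp hP
    have hRe : R e ∈ LinearMap.range T := by
      rw [← hRv, ← hT.apply_of_mem_range hPe, ← hT.commute he heT hP' hP'e]
      exact ⟨_, rfl⟩
    rw [hRv, hRv]
    have hjR : ((j : ℝ) * δ) • R e ≤ R c := by
      have := hP'.mono hj
      rwa [map_smul] at this
    have hjR' : R c ≤ (((j : ℝ) + 1) * δ) • R e := by
      have := hP'.mono hj'
      rwa [map_smul] at this
    have hkR : ((k : ℝ) * δ) • R e ≤ R m := by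
      have := hP.mono hk
      rwa [map_smul, hRv', hRv'] at this
    have hkR' : R m ≤ (((k : ℝ) + 1) * δ) • R e := by
      have := hP.mono hk'
      rwa [map_smul, hRv', hRv'] at this
    have ht0 : 0 ≤ ((k : ℝ) + 1) * δ := by positivity
    have hRf : |R f| ≤ (((k : ℝ) + 1) * δ) • e :=
      ((abs_map_le_of_nonneg hR.nonneg hfm).trans hkR').trans
        (smul_le_smul_of_nonneg_left (hR.le_self e he.1) ht0)
    have hRfV : R f ∈ LinearMap.range V := by
      rw [← hV.apply_of_mem_range hf, ← hV.commute he heV hR (hTV.range_le hRe)]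
      exact ⟨_, rfl⟩
    have hmain := abs_sub_le_of_abs_le_smul hT.nonneg hTe hU.nonneg (hU.apply_of_mem_range heU)
      hV he.1 heV hc hRfV ht0 hRf
    rw [hU.commute he heU hR (hTU.range_le hRe), hT.commute he heT hR hRe, ← map_sub] at hmain
    -- `R` commutes with the absolute value; only this half of the equality matters here
    have habs : R |U f - T f| ≤ |R (U f - T f)| := by
      set h := U f - T f
      have h1 : |h| ≤ |R h| + |h - R h| := by simpa using abs_add_le (R h) (h - R h)
      have h2 : R |h - R h| ≤ 0 := by
        have h3 : |h - R h| ≤ |h| - R |h| := by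
          simpa using abs_map_le_of_nonneg hR.compl.nonneg (le_refl |h|)
        simpa [hR.idem] using hR.mono h3
      calc R |h| ≤ R |R h| + R |h - R h| := by rw [← map_add]; exact hR.mono h1
        _ ≤ |R h| + 0 := add_le_add (hR.le_self _ (abs_nonneg _)) h2
        _ = |R h| := add_zero _
    have hw' : (((j : ℝ) * δ) * ((k : ℝ) * δ)) • R e ≤ R w := by
      have hmem := hw ⟨(j : ℝ) * δ, (k : ℝ) * δ, R e, by positivity, by positivity, hRe,
        hR.inf_compl_eq_zero he.1 he.1, hjR.trans (hR.le_self c hc0),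
        hkR.trans (hR.le_self m hm0), rfl⟩
      have := hR.mono hmem
      rwa [map_smul, hR.idem] at this
    calc R |U f - T f| = R (R |U f - T f|) := (hR.idem _).symm
      _ ≤ R ((2 * (((k : ℝ) + 1) * δ)) • c) := hR.mono (habs.trans hmain)
      _ = (2 * (((k : ℝ) + 1) * δ)) • R c := map_smul _ _ _
      _ ≤ (2 * (((k : ℝ) + 1) * δ)) • (((j : ℝ) + 1) * δ) • R e :=
          smul_le_smul_of_nonneg_left hjR' (by positivity)
      _ = (2 : ℝ) • (((j : ℝ) * δ) * ((k : ℝ) * δ)) • R e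
          + (2 * δ) • (((j : ℝ) * δ) • R e + ((k : ℝ) * δ) • R e + δ • R e) := by module
      _ ≤ (2 : ℝ) • R w + (2 * δ) • (R c + R m + δ • R e) :=
          add_le_add (smul_le_smul_of_nonneg_left hw' zero_le_two)
            (smul_le_smul_of_nonneg_left (add_le_add_left (add_le_add hjR hkR) _) (by positivity))
      _ = R ((2 : ℝ) • w + (2 * δ) • (c + m + δ • e)) := by
          simp only [map_add, map_smul]
  refine le_of_forall_nat_smul_sub_le (z := (2 : ℝ) • (c + m + e)) fun n => ?_
  have hn : (0 : ℝ) < (n : ℝ) + 1 := by positivity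
  have hd := hδ ((n : ℝ) + 1)⁻¹ (inv_pos.2 hn)
  have hd1 : ((n : ℝ) + 1)⁻¹ ≤ 1 := inv_le_one_of_one_le₀ (by simp)
  have hd2 : (n : ℝ) * (2 * ((n : ℝ) + 1)⁻¹) ≤ 2 := by
    have : (n : ℝ) * ((n : ℝ) + 1)⁻¹ ≤ 1 := by
      rw [← div_eq_mul_inv, div_le_one hn]; linarith
    linarith
  have hsum : c + m + ((n : ℝ) + 1)⁻¹ • e ≤ c + m + e :=
    add_le_add_right ((smul_le_smul_of_nonneg_right hd1 he.1).trans (one_smul ℝ e).le) _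
  calc (n : ℝ) • (|U f - T f| - (2 : ℝ) • w)
      ≤ (n : ℝ) • (2 * ((n : ℝ) + 1)⁻¹) • (c + m + ((n : ℝ) + 1)⁻¹ • e) :=
        smul_le_smul_of_nonneg_left (sub_le_iff_le_add'.2 hd) n.cast_nonneg
    _ ≤ (n : ℝ) • (2 * ((n : ℝ) + 1)⁻¹) • (c + m + e) :=
        smul_le_smul_of_nonneg_left (smul_le_smul_of_nonneg_left hsum (by positivity))
          n.cast_nonneg
    _ = ((n : ℝ) * (2 * ((n : ℝ) + 1)⁻¹)) • (c + m + e) := smul_smul _ _ _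
    _ ≤ (2 : ℝ) • (c + m + e) :=
        smul_le_smul_of_nonneg_right hd2 (add_nonneg (add_nonneg hc0 hm0) he.1)

end RieszMixing

open RieszMixing

theorem theorem4p10 {E : Type u} [AddCommGroup E] [ConditionallyCompleteLattice E]
    [IsOrderedAddMonoid E] [Module ℝ E] [IsOrderedModule ℝ E]
    (T U V : E →ₗ[ℝ] E) (e : E)
    (hT : RieszMixing.IsCondExp T) (hE : RieszMixing.IsTUniversallyComplete T)
    (he : RieszMixing.IsWeakOrderUnit e) (hTe : T e = e)
    (hU : RieszMixing.IsCondExp U) (hTU : RieszMixing.IsCompatible T U)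
    (hV : RieszMixing.IsCondExp V) (hTV : RieszMixing.IsCompatible T V)
    (f : E) (hf : f ∈ RieszMixing.LInfty T) (hfV : f ∈ LinearMap.range V) :
    -- the norms, the coefficient and the product below are well defined
    U f - T f ∈ RieszMixing.LInfty T ∧
    (∀ Q ∈ RieszMixing.bandProjections e V, U (Q e) - T (Q e) ∈ RieszMixing.LInfty T) ∧
    BddAbove (RieszMixing.phiSet e T U V) ∧
    BddAbove (RieszMixing.mulSet e (RieszMixing.phi e T U V) (RieszMixing.normInfty T f)) ∧
    -- the inequalities
    RieszMixing.norm1 T (U f - T f) ≤ RieszMixing.normInfty T (U f - T f) ∧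
    RieszMixing.normInfty T (U f - T f) ≤
      (2 : ℝ) • RieszMixing.mulPos e (RieszMixing.phi e T U V) (RieszMixing.normInfty T f) := by
  open RieszMixing in
  have heT : e ∈ LinearMap.range T := ⟨e, hTe⟩
  have hUTf : U f - T f ∈ LInfty T := by
    obtain ⟨g, hg⟩ : (rangeBounds T f).Nonempty := hf
    exact ⟨_, two_smul_mem_rangeBounds hT hU hTU hg⟩
  have hQbound : ∀ Q ∈ bandProjections e V, (2 : ℝ) • e ∈ rangeBounds T (U (Q e) - T (Q e)) := by
    intro Q hQ
    refine two_smul_mem_rangeBounds (f := Q e) hT hU hTU ⟨heT, he.1, ?_⟩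
    simpa [abs_of_nonneg he.1] using hQ.1.abs_apply_le e
  have hQL : ∀ Q ∈ bandProjections e V, U (Q e) - T (Q e) ∈ LInfty T :=
    fun Q hQ => ⟨_, hQbound Q hQ⟩
  have hphi_le : ∀ x ∈ phiSet e T U V, x ≤ (2 : ℝ) • e := by
    rintro _ ⟨Q, hQ, rfl⟩
    exact normInfty_le (hQbound Q hQ)
  have hphi_bdd : BddAbove (phiSet e T U V) := ⟨_, hphi_le⟩
  have hproj : ∀ Q, IsOrderProjection Q → Q e ∈ LinearMap.range V → Q ∈ bandProjections e V :=
    fun Q hQ hQe => ⟨hQ.isBandProjection, hQe⟩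
  have hzero : (0 : E →ₗ[ℝ] E) ∈ bandProjections e V :=
    hproj 0 ⟨fun x _ => le_rfl, fun x hx => hx, fun x => rfl⟩ (by simp)
  have hne : (phiSet e T U V).Nonempty := ⟨_, 0, hzero, rfl⟩
  have hlub : IsLUB (phiSet e T U V) (phi e T U V) :=
    isLUB_csSup hne hphi_bdd
  have hphi0 : 0 ≤ phi e T U V :=
    (normInfty_nonneg (hQL 0 hzero)).trans (hlub.1 ⟨0, hzero, rfl⟩)
  have hphiT : phi e T U V ∈ LinearMap.range T := by
    refine hT.mem_range_of_isLUB hne ?_ hlub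
    rintro _ ⟨Q, hQ, rfl⟩
    exact hT.normInfty_mem_range (hQL Q hQ)
  have hmul_bdd : BddAbove (mulSet e (phi e T U V) (normInfty T f)) :=
    bddAbove_mulSet (hlub.2 hphi_le) (normInfty_nonneg hf)
  have hzero_mem := zero_mem_rangeMulSet (T := T) he.1 hphi0 (normInfty_nonneg hf)
  have hw : IsLUB (rangeMulSet T e (phi e T U V) (normInfty T f))
      (sSup (rangeMulSet T e (phi e T U V) (normInfty T f))) :=
    isLUB_csSup ⟨0, hzero_mem⟩ (hmul_bdd.mono (rangeMulSet_subset _ _ _ _))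
  refine ⟨hUTf, hQL, hphi_bdd, hmul_bdd, hT.norm1_le_normInfty hUTf, ?_⟩
  refine (normInfty_le (g := (2 : ℝ) • sSup (rangeMulSet T e (phi e T U V) (normInfty T f)))
    ⟨?_, ?_, ?_⟩).trans (smul_le_smul_of_nonneg_left ?_ zero_le_two)
  · exact Submodule.smul_mem _ _
      (hT.mem_range_of_isLUB (Set.nonempty_of_mem hzero_mem) (rangeMulSet_subset_range _ _ _ _) hw)
  · exact smul_nonneg zero_le_two (hw.1 hzero_mem)
  · refine abs_sub_le_two_smul hT he hTe hU hTU hV hTV (fun Q hQ hQe => ?_) hphi0 hphiT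
      (normInfty_nonneg hf) (hT.normInfty_mem_range hf) (abs_le_normInfty hf) hfV hw.1
    have hQ' := hproj Q hQ hQe
    exact (abs_le_normInfty (hQL Q hQ')).trans (hlub.1 ⟨Q, hQ', rfl⟩)
  · exact hw.2 fun x hx => le_csSup hmul_bdd (rangeMulSet_subset _ _ _ _ hx)
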